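/- Let $S$ be a non-empty set and let $\mathcal F$ be a set of finite subsets of $S$ with $\emptyset\in\mathcal F$, with $\{s\}\in\mathcal F$ for all $s\in S$, and such that $F\cup F'\in\mathcal F$ whenever $F,F'\in\mathcal F$ and $F\cap F'\neq\emptyset$. A set $C\subseteq S$ is *connected* if for any $x,y\in C$ there is $F\in\mathcal F$ with $F\subseteq C$ and $x,y\in F$. Let $\mathcal C$ be the set of connected sets. The pair $(S,\mathcal C)$ is the *connectoid* induced by $\mathcal F$, and it is *connected* if $S\in\mathcal C$. A *necklace* is a connected set $N$ for which there are finite connected sets $(H_n)_{n\in\mathbb N}$ with $N=\bigcup_n H_n$ such that $H_i\cap H_j\neq\emptyset$ if and only if $|i-j|\le 1$. A set $W\subseteq S$ is *dispersed* if every necklace has finite intersection with $W$. For disjoint finite sets $X,Y\subseteq S$, an *$X$–$Y$ link* is a finite connected set of the form $C_1\cup C_2$, where $C_1,C_2$ are connected, $X\subseteq C_1\setminus C_2$, $Y\subseteq C_2\setminus C_1$ and $C_1\cap C_2\ne\emptyset$. Two $X$–$Y$ links are *internally disjoint* if they intersect only in $X\cup Y$. A *fat $TK_{\aleph_0}$*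 is a sequence $(B_n)_{n\in\mathbb N}$ of pairwise disjoint finite connected sets (its *branch sets*) together with, for any $n\ne m$, uncountably many pairwise internally disjoint $B_n$–$B_m$ links. A set $W\subseteq S$ is *fat $TK_{\aleph_0}$-dispersed* if for every fat $TK_{\aleph_0}$ only finitely many branch sets contain an element of $W$. Let $T$ be a rooted undirected graph-theoretic tree with $V(T)\subseteq S$ (its edges need not be related to $\mathcal C$), and let $\le_T$ be its tree order: $u\le_T v$ if and only if $u$ lies on the path in $T$ from the root to $v$. Consider the conditions: (a) for any $C\in\mathcal C$ and any two $\le_T$-incomparable $u,v\in C\cap V(T)$ there is $w\in C\cap V(T)$ with $w\le_T u$ and $w\le_T v$; (b) for any $u\le_T v$ in $V(T)$ there is $C\in\mathcal C$ that contains $u$ and $v$ and avoids every $w<_T u$; (c) for every ray $R$ in $T$ starting at the root there is a necklace containing all but finitely many vertices of $R$. $T$ is a *weak normal tree* if it satisfies (a) and (b), and a *normal tree* if it satisfies (a), (b) and (c). $T$ *contains* $U$ if $U\subseteq V(T)$. **Theorem.** Let $(S,\mathcal C)$ be a connected connectoid with $S \neq \emptyset$ and let $U\subseteq S$. The following are equivalent: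 1. for every $r\in S$ there is a normal tree rooted at $r$ that contains $U$; 2. there is a weak normal tree that contains $U$; 3. there is a rooted tree $T$ with $V(T)\subseteq S$ that contains $U$ and satisfies (a); 4. $U$ is a countable union of dispersed sets; 5. $U$ is a countable union of fat $TK_{\aleph_0}$-dispersed sets. -/

import Mathlib

/-- A connectoid on the ground set `S`, given by the family `fin` of its finite connected sets.
The connected sets of arbitrary size are those of `Connectoid.IsConn`. -/
structure Connectoid (S : Type*) where
  /-- the inducing family of finite sets -/
  fin : Set (Set S)
  finite_of_mem : ∀ F ∈ fin, F.Finite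
  union_mem : ∀ F ∈ fin, ∀ F' ∈ fin, (F ∩ F').Nonempty → F ∪ F' ∈ fin
  singleton_mem : ∀ s : S, {s} ∈ fin
  empty_mem : ∅ ∈ fin

/-- A rooted undirected tree (in the sense of graph theory) whose vertices are elements of `S`. -/
structure RootedTreeIn (S : Type*) where
  verts : Set S
  graph : SimpleGraph verts
  isTree : graph.IsTree
  root : verts

namespace RootedTreeIn

/-- The tree order: `u ≤ v` if `u` lies on the path from the root to `v`. -/
def le {S : Type*} (T : RootedTreeIn S) (u v : T.verts) : Prop :=
  ∃ p : T.graph.Walk T.root v, p.IsPath ∧ u ∈ p.support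

/-- The strict tree order. -/
def lt {S : Type*} (T : RootedTreeIn S) (u v : T.verts) : Prop :=
  T.le u v ∧ u ≠ v

/-- The sequence `R` enumerates, in order, the vertices of a ray of `T` starting at the root. -/
def IsRootedRay {S : Type*} (T : RootedTreeIn S) (R : ℕ → T.verts) : Prop :=
  R 0 = T.root ∧ Function.Injective R ∧ ∀ n, T.graph.Adj (R n) (R (n + 1))

end RootedTreeIn

namespace Connectoid

/-- Connected sets of a connectoid. -/
def IsConn {S : Type*} (c : Connectoid S) (C : Set S) : Prop :=
  ∀ x ∈ C, ∀ y ∈ C, ∃ F ∈ c.fin, F ⊆ C ∧ x ∈ F ∧ y ∈ F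

/-- A connectoid is connected if its ground set is a connected set. -/
def Connected {S : Type*} (c : Connectoid S) : Prop :=
  c.IsConn Set.univ

/-- Necklaces: connected sets that are a union of a sequence of finite connected sets in which
exactly the consecutive (and equal) members intersect. -/
def IsNecklace {S : Type*} (c : Connectoid S) (N : Set S) : Prop :=
  c.IsConn N ∧ ∃ H : ℕ → Set S,
    (∀ n, (H n).Finite ∧ c.IsConn (H n)) ∧
    N = ⋃ n, H n ∧
    ∀ i j : ℕ, (H i ∩ H j).Nonempty ↔ |(i : ℤ) - (j : ℤ)| ≤ 1

/-- A set is dispersed if it meets every necklace in a finite set. -/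
def IsDispersed {S : Type*} (c : Connectoid S) (U : Set S) : Prop :=
  ∀ N : Set S, c.IsNecklace N → (N ∩ U).Finite

/-- `L` is an `X`--`Y` link. -/
def IsLink {S : Type*} (c : Connectoid S) (X Y L : Set S) : Prop :=
  L.Finite ∧ c.IsConn L ∧ ∃ C₁ C₂ : Set S,
    L = C₁ ∪ C₂ ∧ c.IsConn C₁ ∧ c.IsConn C₂ ∧
    X ⊆ C₁ \ C₂ ∧ Y ⊆ C₂ \ C₁ ∧ (C₁ ∩ C₂).Nonempty

/-- A fat `TK_{ℵ₀}`: a sequence of disjoint finite connected branch sets together with, for any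
two of them, uncountably many links between them that pairwise meet only in the two branch
sets. -/
structure FatTK {S : Type*} (c : Connectoid S) where
  branch : ℕ → Set S
  links : ℕ → ℕ → Set (Set S)
  branch_finite : ∀ n, (branch n).Finite
  branch_conn : ∀ n, c.IsConn (branch n)
  branch_disjoint : ∀ n m, n ≠ m → Disjoint (branch n) (branch m)
  links_isLink : ∀ n m, n ≠ m → ∀ L ∈ links n m, c.IsLink (branch n) (branch m) L
  links_disjoint : ∀ n m, n ≠ m → ∀ L ∈ links n m, ∀ L' ∈ links n m, L ≠ L' →
    L ∩ L' ⊆ branch n ∪ branch m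
  links_uncountable : ∀ n m, n ≠ m → ¬ (links n m).Countable

/-- A set is fat `TK_{ℵ₀}`-dispersed if it meets only finitely many branch sets of every
fat `TK_{ℵ₀}`. -/
def IsFatTKDispersed {S : Type*} (c : Connectoid S) (U : Set S) : Prop :=
  ∀ K : c.FatTK, {n : ℕ | (K.branch n ∩ U).Nonempty}.Finite

/-- First condition on weak normal trees: a connected set containing two incomparable vertices
of the tree contains a common lower bound of them. -/
def IsQuasiWeakNormal {S : Type*} (c : Connectoid S) (T : RootedTreeIn S) : Prop :=
  ∀ C : Set S, c.IsConn C → ∀ u v : T.verts, (u : S) ∈ C → (v : S) ∈ C →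
    ¬ T.le u v → ¬ T.le v u → ∃ w : T.verts, (w : S) ∈ C ∧ T.le w u ∧ T.le w v

/-- Weak normal trees. -/
def IsWeakNormal {S : Type*} (c : Connectoid S) (T : RootedTreeIn S) : Prop :=
  c.IsQuasiWeakNormal T ∧
  ∀ u v : T.verts, T.le u v → ∃ C : Set S, c.IsConn C ∧ (u : S) ∈ C ∧ (v : S) ∈ C ∧
    ∀ w : T.verts, T.lt w u → (w : S) ∉ C

/-- Normal trees: weak normal trees in which every rooted ray has all but finitely many of its
vertices in a common necklace. -/
def IsNormal {S : Type*} (c : Connectoid S) (T : RootedTreeIn S) : Prop :=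
  c.IsWeakNormal T ∧
  ∀ R : ℕ → T.verts, T.IsRootedRay R →
    ∃ N : Set S, c.IsNecklace N ∧ {n : ℕ | (R n : S) ∉ N}.Finite

end Connectoid

/-! Conditions 1 to 5 are proved as a cycle; 1 → 2 → 3 only forgets data.

3 → 4: split `U` by distance from the root. Condition (a) gives every connected set that meets the
tree a least vertex. If a level met a necklace infinitely often, the least vertices of the tails of
the necklace would have bounded height and hence be eventually constant, although no element lies in
all tails (`IsQuasiWeakNormal.isDispersed_level`).

4 → 5: links through infinitely many branch sets of a fat `TK_{ℵ₀}` can be strung together to a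
necklace (`FatTK.exists_necklace`).

5 → 1: grow a tree from `r` by selecting a vertex in each component left by the current chain of
ancestors. Any such tree satisfies (a) and (b), so everything depends on the selection rule. A
diligent rule has two recurring duties: to select from a `W i` of least available index, and to work
off countable agendas. Along a branch with components `D n`, the union `M` of the agendas is closed
in three ways: each element of `M` eventually leaves `D n`; every `M ∩ D n` is connected; and if
finite sets `X`, `Y` in `M` lack uncountably many internally disjoint links, then `M` blocks their
links. The first two properties yield a necklace through the branch, which is (c). If some `u` in `W
i` were never selected, it would stay in all components of a branch. This branch has infinitely many
vertices in one `W j`, and `u` is not in `M`. Disjoint finite connected sets in `M` around these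
vertices can be joined through `u` with no further element of `M`, so `M` does not block their
links. Hence they are branch sets of a fat `TK_{ℵ₀}`, each meeting `W j`, a contradiction
(`IsBranch.exists_fatTK`). -/

/-- A finite set can meet only finitely many members of a disjoint family. The relation also covers
links, which are disjoint only outside their end sets. -/
theorem Set.Finite.of_injective_rel {α β : Type*} {I : Set α} {Z : Set β} (hZ : Z.Finite)
    (r : α → β → Prop) (h : ∀ i ∈ I, ∃ z ∈ Z, r i z)
    (hr : ∀ i ∈ I, ∀ j ∈ I, ∀ z, r i z → r j z → i = j) : I.Finite := by
  refine Set.Finite.subset (s := ⋃ z ∈ Z, {i ∈ I | r i z}) (hZ.biUnion fun z _ => ?_)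
    fun i hi => ?_
  · exact Set.Subsingleton.finite fun i hi j hj => hr i hi.1 j hj.1 z hi.2 hj.2
  · obtain ⟨z, hz, hiz⟩ := h i hi
    exact Set.mem_biUnion hz ⟨hi, hiz⟩

/-! ### Connected sets, necklaces, and stringing links together (4 → 5). -/

namespace Connectoid

variable {S : Type*} (c : Connectoid S)

theorem isConn_of_mem {F : Set S} (hF : F ∈ c.fin) : c.IsConn F :=
  fun _ hx _ hy => ⟨F, hF, subset_rfl, hx, hy⟩

variable {c}

theorem IsConn.union {A B : Set S} (hA : c.IsConn A) (hB : c.IsConn B)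
    (h : (A ∩ B).Nonempty) : c.IsConn (A ∪ B) := by
  obtain ⟨z, hzA, hzB⟩ := h
  have key : ∀ x ∈ A ∪ B, ∃ F ∈ c.fin, F ⊆ A ∪ B ∧ x ∈ F ∧ z ∈ F := by
    rintro x (hx | hx)
    · obtain ⟨F, hF, hs, h1, h2⟩ := hA x hx z hzA
      exact ⟨F, hF, hs.trans Set.subset_union_left, h1, h2⟩
    · obtain ⟨F, hF, hs, h1, h2⟩ := hB x hx z hzB
      exact ⟨F, hF, hs.trans Set.subset_union_right, h1, h2⟩
  intro x hx y hy
  obtain ⟨F, hF, hs, h1, h2⟩ := key x hx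
  obtain ⟨F', hF', hs', h1', h2'⟩ := key y hy
  exact ⟨F ∪ F', c.union_mem F hF F' hF' ⟨z, h2, h2'⟩, Set.union_subset hs hs',
    Or.inl h1, Or.inr h1'⟩

theorem isConn_iUnion_of_directed {P : ℕ → Set S} (hP : ∀ n, c.IsConn (P n)) (hm : Monotone P) :
    c.IsConn (⋃ n, P n) := by
  intro x hx y hy
  obtain ⟨i, hi⟩ := Set.mem_iUnion.1 hx
  obtain ⟨j, hj⟩ := Set.mem_iUnion.1 hy
  obtain ⟨F, hF, hs, h⟩ := hP (max i j) x (hm (le_max_left i j) hi) y (hm (le_max_right i j) hj)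
  exact ⟨F, hF, hs.trans (Set.subset_iUnion P _), h⟩

theorem isConn_iUnion_of_consecutive {H : ℕ → Set S} (hH : ∀ n, c.IsConn (H n))
    (hne : ∀ n, (H n ∩ H (n + 1)).Nonempty) : c.IsConn (⋃ n, H n) := by
  rw [← Set.iUnion_accumulate]
  refine isConn_iUnion_of_directed (fun n => ?_) Set.monotone_accumulate
  induction n with
  | zero => simpa using hH 0
  | succ n ih =>
    rw [Set.accumulate_succ]
    obtain ⟨x, hx, hx'⟩ := hne n
    exact ih.union (hH _) ⟨x, Set.mem_accumulate.2 ⟨n, le_rfl, hx⟩, hx'⟩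

/-- Every finite subset of a connected set lies in a finite connected subset. -/
theorem IsConn.exists_finite_superset {C A : Set S} (hC : c.IsConn C) (hA : A.Finite)
    (hAC : A ⊆ C) : ∃ F : Set S, F.Finite ∧ c.IsConn F ∧ A ⊆ F ∧ F ⊆ C := by
  rcases A.eq_empty_or_nonempty with rfl | ⟨a, ha⟩
  · exact ⟨∅, Set.finite_empty, c.isConn_of_mem c.empty_mem, subset_rfl, Set.empty_subset _⟩
  suffices h : ∃ F ∈ c.fin, a ∈ F ∧ A ⊆ F ∧ F ⊆ C by
    obtain ⟨F, hF, -, h⟩ := h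
    exact ⟨F, c.finite_of_mem F hF, c.isConn_of_mem hF, h⟩
  have haC := hAC ha
  clear ha
  induction A, hA using Set.Finite.induction_on with
  | empty => exact ⟨{a}, c.singleton_mem a, rfl, Set.empty_subset _, by simpa using haC⟩
  | @insert x A _ _ ih =>
    obtain ⟨F, hF, haF, hAF, hFC⟩ := ih ((Set.subset_insert _ _).trans hAC)
    obtain ⟨F', hF', hs, ha', hx'⟩ := hC a haC x (hAC (Set.mem_insert _ _))
    refine ⟨F ∪ F', c.union_mem F hF F' hF' ⟨a, haF, ha'⟩, Or.inl haF, ?_,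
      Set.union_subset hFC hs⟩
    exact Set.insert_subset (Or.inr hx') (hAF.trans Set.subset_union_left)

theorem isNecklace_iUnion {H : ℕ → Set S} (hfin : ∀ n, (H n).Finite) (hH : ∀ n, c.IsConn (H n))
    (hne : ∀ n, (H n ∩ H (n + 1)).Nonempty) (hdisj : ∀ i j, i + 2 ≤ j → Disjoint (H i) (H j)) :
    c.IsNecklace (⋃ n, H n) := by
  refine ⟨isConn_iUnion_of_consecutive hH hne, H, fun n => ⟨hfin n, hH n⟩, rfl, fun i j => ?_⟩
  rw [abs_le]
  constructor
  · intro h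
    by_contra hlt
    rcases le_or_gt (i + 2) j with hij | hij
    · exact Set.not_disjoint_iff_nonempty_inter.2 h (hdisj i j hij)
    · rcases le_or_gt (j + 2) i with hji | hji
      · exact Set.not_disjoint_iff_nonempty_inter.2 h (hdisj j i hji).symm
      · omega
  · intro h
    obtain rfl | rfl | rfl : j = i ∨ j = i + 1 ∨ i = j + 1 := by omega
    · exact (hne j).mono fun x hx => ⟨hx.1, hx.1⟩
    · exact hne i
    · rw [Set.inter_comm]; exact hne j

theorem IsLink.left_union_right_subset {X Y L : Set S} (h : c.IsLink X Y L) : X ∪ Y ⊆ L := by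
  obtain ⟨-, -, C₁, C₂, rfl, -, -, hX, hY, -⟩ := h
  exact Set.union_subset_union (fun x hx => (hX hx).1) fun x hx => (hY hx).1

/-- Deleting finitely many elements outside the branch sets leaves some link intact. -/
theorem FatTK.exists_link_avoiding (K : c.FatTK) {n m : ℕ} (hnm : n ≠ m) {Z : Set S}
    (hZ : Z.Finite) : ∃ L ∈ K.links n m, L ∩ Z ⊆ K.branch n ∪ K.branch m := by
  by_contra! hcon
  refine K.links_uncountable n m hnm (Set.Finite.countable ?_)
  refine hZ.of_injective_rel (fun L z => z ∈ L ∧ z ∉ K.branch n ∪ K.branch m) (fun L hL => ?_) ?_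
  · obtain ⟨z, hz, hz'⟩ := Set.not_subset.1 (hcon L hL)
    exact ⟨z, hz.2, hz.1, hz'⟩
  · intro L hL L' hL' z hz hz'
    by_contra hne
    exact hz.2 (K.links_disjoint n m hnm L hL L' hL' hne ⟨hz.1, hz'.1⟩)

theorem FatTK.finite_meeting (K : c.FatTK) {Z : Set S} (hZ : Z.Finite) :
    {n | ¬ Disjoint (K.branch n) Z}.Finite := by
  refine hZ.of_injective_rel (fun n z => z ∈ K.branch n) (fun n hn => ?_) ?_
  · obtain ⟨z, hz, hz'⟩ := Set.not_disjoint_iff.1 hn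
    exact ⟨z, hz', hz⟩
  · intro n _ m _ z hz hz'
    by_contra hne
    exact Set.disjoint_left.1 (K.branch_disjoint n m hne) hz hz'

/-- Links through infinitely many branch sets of a fat `TK_{ℵ₀}` can be strung together to a
necklace. -/
theorem FatTK.exists_necklace (K : c.FatTK) {I : Set ℕ} (hI : I.Infinite)
    (hIne : ∀ n ∈ I, (K.branch n).Nonempty) :
    ∃ N, c.IsNecklace N ∧ {n ∈ I | K.branch n ⊆ N}.Infinite := by
  -- a state: the union of the old links, the current link, and the index of its last branch set
  have step : ∀ s : Set S × Set S × I, s.1.Finite → s.2.1.Finite →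
      Disjoint (K.branch s.2.2) s.1 →
      ∃ (L : Set S) (m : I), c.IsLink (K.branch s.2.2) (K.branch m) L ∧
        Disjoint (K.branch m) (s.1 ∪ s.2.1) ∧ Disjoint L s.1 ∧ (s.2.2 : ℕ) < m := by
    rintro ⟨A, L₀, n⟩ hA hL₀ hn
    obtain ⟨m, ⟨hmI, hm⟩, hnm⟩ := (hI.sdiff (K.finite_meeting (hA.union hL₀))).exists_gt n
    simp only [Set.mem_ofPred_eq, not_not] at hm
    -- Only the links before the current one have to be avoided: consecutive members of a necklace
    -- must meet, and `L` and `L₀` may share more than the branch set of `n`.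
    obtain ⟨L, hL, hLA⟩ := K.exists_link_avoiding hnm.ne hA
    refine ⟨L, ⟨m, hmI⟩, K.links_isLink n m hnm.ne L hL, hm, ?_, hnm⟩
    rw [Set.disjoint_left]
    intro x hx hxA
    rcases hLA ⟨hx, hxA⟩ with h | h
    · exact Set.disjoint_left.1 hn h hxA
    · exact Set.disjoint_left.1 hm h (Or.inl hxA)
  let State := {s : Set S × Set S × I // s.1.Finite ∧ s.2.1.Finite ∧ Disjoint (K.branch s.2.2) s.1}
  have step' : ∀ s : State, ∃ t : State, t.1.1 = s.1.1 ∪ s.1.2.1 ∧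
      c.IsLink (K.branch s.1.2.2) (K.branch t.1.2.2) t.1.2.1 ∧
      Disjoint t.1.2.1 s.1.1 ∧ (s.1.2.2 : ℕ) < t.1.2.2 := by
    rintro ⟨s, h1, h2, h3⟩
    obtain ⟨L, m, hL, hm, hd, hlt⟩ := step s h1 h2 h3
    exact ⟨⟨(s.1 ∪ s.2.1, L, m), h1.union h2, hL.1, hm⟩, rfl, hL, hd, hlt⟩
  choose nxt hA hL hd hlt using step'
  obtain ⟨n₀, hn₀⟩ := hI.nonempty
  let st : ℕ → State := fun i =>
    nxt^[i] ⟨(∅, ∅, ⟨n₀, hn₀⟩), Set.finite_empty, Set.finite_empty, Set.disjoint_empty _⟩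
  have hst : ∀ i, st (i + 1) = nxt (st i) := fun i => Function.iterate_succ_apply' _ _ _
  have hlink : ∀ i, c.IsLink (K.branch (st i).1.2.2) (K.branch (st (i + 1)).1.2.2)
      (st (i + 1)).1.2.1 := fun i => by rw [hst]; exact hL _
  have hsub : ∀ i j, i < j → (st i).1.2.1 ⊆ (st j).1.1 := by
    intro i j hij
    induction j, hij using Nat.le_induction with
    | base => rw [hst, hA]; exact Set.subset_union_right
    | succ j _ ih => rw [hst, hA]; exact ih.trans Set.subset_union_left
  have hmono : StrictMono fun i => ((st i).1.2.2 : ℕ) :=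
    strictMono_nat_of_lt_succ fun i => by rw [hst]; exact hlt _
  -- The shift by one drops the empty link of the initial state.
  refine ⟨⋃ i, (st (i + 1)).1.2.1, isNecklace_iUnion (fun i => (hlink i).1) (fun i => (hlink i).2.1)
    (fun i => ?_) (fun i j hij => ?_), ?_⟩
  · obtain ⟨x, hx⟩ := hIne _ (st (i + 1)).1.2.2.2
    exact ⟨x, (hlink i).left_union_right_subset (Or.inr hx),
      (hlink (i + 1)).left_union_right_subset (Or.inl hx)⟩
  · have h := hd (st j)
    rw [← hst] at h
    exact (h.mono_right (hsub (i + 1) j (by omega))).symm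
  · refine (Set.infinite_range_of_injective hmono.injective).mono ?_
    rintro _ ⟨i, rfl⟩
    exact ⟨(st i).1.2.2.2, (Set.subset_union_left.trans (hlink i).left_union_right_subset).trans
      (Set.subset_iUnion (fun i => (st (i + 1)).1.2.1) i)⟩

/-- Branch sets are disjoint, so a necklace containing infinitely many that meet `U` has infinitely
many elements in `U`. -/
theorem IsDispersed.isFatTKDispersed {U : Set S} (hU : c.IsDispersed U) :
    c.IsFatTKDispersed U := by
  intro K
  by_contra hinf
  obtain ⟨N, hN, hNI⟩ := K.exists_necklace hinf fun n hn => hn.mono Set.inter_subset_left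
  refine hNI ((hU N hN).of_injective_rel (fun n z => z ∈ K.branch n) ?_ ?_)
  · rintro n ⟨⟨x, hx, hxU⟩, hn⟩
    exact ⟨x, ⟨hn hx, hxU⟩, hx⟩
  · intro n _ m _ z hz hz'
    by_contra hne
    exact Set.disjoint_left.1 (K.branch_disjoint n m hne) hz hz'

end Connectoid

/-! ### Heights in rooted trees and the levels of a tree with (a) (3 → 4). -/

namespace RootedTreeIn

variable {S : Type*} {T : RootedTreeIn S}

/-- Paths in a tree are unique, hence geodesic. Distance from the root thus serves as a height
function for the tree order. -/
theorem length_eq_dist {u v : T.verts} (p : T.graph.Walk u v) (hp : p.IsPath) :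
    p.length = T.graph.dist u v := by
  obtain ⟨q, hq, hl⟩ := T.isTree.connected.exists_path_of_dist u v
  rw [(T.isTree.existsUnique_path u v).unique hp hq, hl]

theorem le.dist_le {u v : T.verts} (h : T.le u v) :
    T.graph.dist T.root u ≤ T.graph.dist T.root v := by
  classical
  obtain ⟨p, hp, hu⟩ := h
  rw [← length_eq_dist p hp, ← length_eq_dist _ (hp.takeUntil hu)]
  exact p.length_takeUntil_le_length hu

theorem le.eq_of_dist_le {u v : T.verts} (h : T.le u v)
    (hd : T.graph.dist T.root v ≤ T.graph.dist T.root u) : u = v := by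
  classical
  obtain ⟨p, hp, hu⟩ := h
  by_contra hne
  have := p.length_takeUntil_lt_length hu hne
  rw [length_eq_dist p hp, length_eq_dist _ (hp.takeUntil hu)] at this
  omega

end RootedTreeIn

namespace Connectoid

variable {S : Type*} {c : Connectoid S} {T : RootedTreeIn S}

/-- A connected set that meets the tree contains a least vertex of the tree. -/
theorem IsQuasiWeakNormal.exists_least (hT : c.IsQuasiWeakNormal T) {C : Set S} (hC : c.IsConn C)
    (hne : ∃ v : T.verts, (v : S) ∈ C) :
    ∃ w : T.verts, (w : S) ∈ C ∧ ∀ v : T.verts, (v : S) ∈ C → T.le w v := by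
  -- A vertex of minimal height in `C` is least: by (a), an incomparable vertex would share with it
  -- a lower bound in `C`, which by minimality is the vertex itself.
  obtain ⟨w, hw, hmin⟩ := exists_minimalFor_of_wellFoundedLT (fun v : T.verts => (v : S) ∈ C)
    (fun v => T.graph.dist T.root v) hne
  refine ⟨w, hw, fun v hv => ?_⟩
  by_contra hwv
  by_cases hvw : T.le v w
  · obtain rfl := hvw.eq_of_dist_le (hmin hv hvw.dist_le)
    exact hwv hvw
  · obtain ⟨x, hx, hxw, hxv⟩ := hT C hC w v hw hv hwv hvw
    obtain rfl := hxw.eq_of_dist_le (hmin hx hxw.dist_le)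
    exact hwv hxv

/-- If level `n` met the necklace infinitely often, every tail would have a least vertex, of height
at most `n`. From a tail whose least vertex has maximal height onwards, the least vertex cannot
change, yet it has to leave the tails eventually. -/
theorem IsQuasiWeakNormal.isDispersed_level (hT : c.IsQuasiWeakNormal T) (n : ℕ) :
    c.IsDispersed {s | ∃ v : T.verts, (v : S) = s ∧ T.graph.dist T.root v = n} := by
  rintro N ⟨-, H, hH, rfl, hHH⟩
  by_contra hinf
  have htail : ∀ k, c.IsConn (⋃ i, H (i + k)) := fun k =>
    isConn_iUnion_of_consecutive (fun i => (hH _).2) fun i =>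
      (hHH _ _).2 (by rw [abs_le]; push_cast; constructor <;> omega)
  have hmeet : ∀ k, ∃ v : T.verts, (v : S) ∈ (⋃ i, H (i + k)) ∧ T.graph.dist T.root v = n := by
    intro k
    obtain ⟨s, ⟨hs, v, rfl, hv⟩, hsk⟩ := (Set.Infinite.sdiff hinf
      ((Set.finite_lt_nat k).biUnion fun i _ => (hH i).1)).nonempty
    obtain ⟨i, hi⟩ := Set.mem_iUnion.1 hs
    refine ⟨v, Set.mem_iUnion.2 ⟨i - k, ?_⟩, hv⟩
    have hki : k ≤ i := by
      by_contra hlt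
      exact hsk (Set.mem_biUnion (show i < k by omega) hi)
    rwa [Nat.sub_add_cancel hki]
  choose w hw hmin using fun k => hT.exists_least (htail k) ((hmeet k).imp fun _ h => h.1)
  have hbdd : ∀ k, T.graph.dist T.root (w k) ≤ n := by
    intro k
    obtain ⟨v, hv, rfl⟩ := hmeet k
    exact (hmin k v hv).dist_le
  obtain ⟨k, hk⟩ : ∃ k, ∀ l, T.graph.dist T.root (w l) ≤ T.graph.dist T.root (w k) := by
    have hfin : (Set.range fun k => T.graph.dist T.root (w k)).Finite :=
      (Set.finite_le_nat n).subset (by rintro _ ⟨k, rfl⟩; exact hbdd k)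
    obtain ⟨_, ⟨k, rfl⟩, hk⟩ := Set.exists_max_image _ id hfin ⟨_, 0, rfl⟩
    exact ⟨k, fun l => hk _ ⟨l, rfl⟩⟩
  have hconst : ∀ l, k ≤ l → w k = w l := by
    intro l hl
    refine (hmin k (w l) ?_).eq_of_dist_le (hk l)
    obtain ⟨i, hi⟩ := Set.mem_iUnion.1 (hw l)
    refine Set.mem_iUnion.2 ⟨i + (l - k), ?_⟩
    rwa [show i + (l - k) + k = i + l by omega]
  obtain ⟨i, hi⟩ := Set.mem_iUnion.1 (hw k)
  -- The constant vertex lies in member `i + k` and also in a member of index at least `i + k + 2`;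
  -- these are disjoint.
  obtain ⟨j, hj⟩ := Set.mem_iUnion.1 (hw (i + k + 2))
  rw [← hconst _ (by omega)] at hj
  have := (hHH _ _).1 ⟨_, hi, hj⟩
  rw [abs_le] at this
  push_cast at this
  omega

end Connectoid

/-! ### Rooted trees from chains of ancestors. -/

/-- A system of chains, each listing a vertex and its ancestors in descending order, that is closed
under passing to the parent gives a rooted tree whose tree order is read off the chains. -/
theorem RootedTreeIn.exists_of_chains {S : Type*} (V : Set S) (r : S) (hrV : r ∈ V)
    (chain : S → List S) (hr : chain r = [r])
    (hchain : ∀ v ∈ V, v ≠ r → ∃ u ∈ V, chain v = v :: chain u)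
    (hnodup : ∀ v ∈ V, (chain v).Nodup) :
    ∃ T : RootedTreeIn S, T.verts = V ∧ (T.root : S) = r ∧
      (∀ u v : T.verts, T.le u v ↔ (u : S) ∈ chain v) ∧
      ∀ u v : T.verts, T.graph.Adj u v →
        chain v = (v : S) :: chain u ∨ chain u = (u : S) :: chain v := by
  classical
  have hhead : ∀ v ∈ V, ∃ t, chain v = v :: t := by
    intro v hv
    by_cases h : v = r
    · exact ⟨[], h ▸ hr⟩
    · obtain ⟨u, -, hu⟩ := hchain v hv h
      exact ⟨_, hu⟩
  have hinj : ∀ u ∈ V, ∀ v ∈ V, chain u = chain v → u = v := by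
    intro u hu v hv h
    obtain ⟨t, ht⟩ := hhead u hu
    obtain ⟨t', ht'⟩ := hhead v hv
    rw [ht, ht'] at h
    exact (List.cons.inj h).1
  let G : SimpleGraph V :=
    { Adj := fun u v => chain v = (v : S) :: chain u ∨ chain u = (u : S) :: chain v
      symm := ⟨fun _ _ h => h.symm⟩
      loopless := ⟨fun u h => by
        have := h.elim (congrArg List.length) (congrArg List.length)
        simp at this⟩ }
  have hpath : ∀ (n : ℕ) (v : V), (chain v).length = n →
      ∃ p : G.Walk ⟨r, hrV⟩ v, p.IsPath ∧ ∀ u : V, u ∈ p.support ↔ (u : S) ∈ chain v := by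
    intro n
    induction n with
    | zero =>
      intro v hv
      obtain ⟨t, ht⟩ := hhead v v.2
      simp [ht] at hv
    | succ n ih =>
      rintro ⟨v, hvV⟩ hv
      by_cases hvr : v = r
      · subst hvr
        exact ⟨SimpleGraph.Walk.nil, SimpleGraph.Walk.IsPath.nil, fun u => by
          simp [hr, Subtype.ext_iff]⟩
      · obtain ⟨w, hwV, hw⟩ := hchain v hvV hvr
        have hlen : (chain w).length = n := by simpa [hw] using hv
        obtain ⟨p, hp, hps⟩ := ih ⟨w, hwV⟩ hlen
        have hadj : G.Adj ⟨w, hwV⟩ ⟨v, hvV⟩ := Or.inl hw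
        have hnd := hnodup v hvV
        rw [hw, List.nodup_cons] at hnd
        refine ⟨p.concat hadj, hp.concat (fun h => hnd.1 ((hps _).1 h)) hadj, fun u => ?_⟩
        simp [SimpleGraph.Walk.support_concat, hps, hw, Subtype.ext_iff, or_comm]
  have hconn : G.Connected := by
    have : Nonempty V := ⟨⟨r, hrV⟩⟩
    refine SimpleGraph.Connected.mk fun u v => ?_
    obtain ⟨p, -⟩ := hpath _ u rfl
    obtain ⟨q, -⟩ := hpath _ v rfl
    exact p.reachable.symm.trans q.reachable
  have hacyc : G.IsAcyclic := by
    intro v p hp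
    -- On a cycle, both neighbours of a vertex with a longest chain would be its parent, but parents
    -- are unique.
    obtain ⟨x, hx, hmax⟩ := p.support.toFinset.exists_max_image
      (fun u : V => (chain u).length) ⟨v, by simp⟩
    rw [List.mem_toFinset] at hx
    have hq := hp.rotate hx
    have hparent : ∀ y ∈ (p.rotate x hx).support, G.Adj x y → chain x = (x : S) :: chain y := by
      intro y hy hxy
      rcases hxy with h | h
      · have := hmax y (by rw [List.mem_toFinset]; exact (p.mem_support_rotate_iff x hx).1 hy)
        rw [h, List.length_cons] at this
        omega
      · exact h
    have h1 := hparent _ ((p.rotate x hx).getVert_mem_support _) ((p.rotate x hx).adj_snd hq.not_nil)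
    have h2 := hparent _ ((p.rotate x hx).getVert_mem_support _)
      ((p.rotate x hx).adj_penultimate hq.not_nil).symm
    refine hq.snd_ne_penultimate (Subtype.ext (hinj _ (Subtype.prop _) _ (Subtype.prop _) ?_))
    exact (List.cons.inj (h1.symm.trans h2)).2
  refine ⟨⟨V, G, ⟨hconn, hacyc⟩, ⟨r, hrV⟩⟩, rfl, rfl, fun u v => ?_, fun u v h => h⟩
  obtain ⟨p, hp, hps⟩ := hpath _ v rfl
  refine ⟨?_, fun h => ⟨p, hp, (hps u).2 h⟩⟩
  rintro ⟨q, hq, hu⟩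
  have : q = p := congrArg Subtype.val
    ((hacyc.subsingleton_path _ _).elim (⟨q, hq⟩ : G.Path _ _) ⟨p, hp⟩)
  exact (hps u).1 (this ▸ hu)

/-! ### Components and the tree grown by a selection rule. -/

namespace Connectoid

variable {S : Type*} (c : Connectoid S)

/-- The component of `s` in the complement of `Z`; it is empty if `s ∈ Z`. -/
def comp (Z : Set S) (s : S) : Set S :=
  {y | ∃ F ∈ c.fin, Disjoint F Z ∧ s ∈ F ∧ y ∈ F}

variable {c}

theorem self_mem_comp {Z : Set S} {s : S} (h : s ∉ Z) : s ∈ c.comp Z s :=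
  ⟨{s}, c.singleton_mem s, Set.disjoint_singleton_left.2 h, rfl, rfl⟩

theorem disjoint_comp (Z : Set S) (s : S) : Disjoint (c.comp Z s) Z :=
  Set.disjoint_left.2 fun _ ⟨_, _, hd, _, hy⟩ hz => Set.disjoint_left.1 hd hy hz

theorem comp_symm {Z : Set S} {s t : S} (h : t ∈ c.comp Z s) : s ∈ c.comp Z t := by
  obtain ⟨F, hF, hd, hs, ht⟩ := h
  exact ⟨F, hF, hd, ht, hs⟩

theorem comp_trans {Z : Set S} {s t u : S} (h : t ∈ c.comp Z s) (h' : u ∈ c.comp Z t) :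
    u ∈ c.comp Z s := by
  obtain ⟨F, hF, hd, hs, ht⟩ := h
  obtain ⟨F', hF', hd', ht', hu⟩ := h'
  exact ⟨F ∪ F', c.union_mem F hF F' hF' ⟨t, ht, ht'⟩, Set.disjoint_union_left.2 ⟨hd, hd'⟩,
    Or.inl hs, Or.inr hu⟩

theorem comp_eq_of_mem {Z : Set S} {s t : S} (h : t ∈ c.comp Z s) : c.comp Z t = c.comp Z s :=
  Set.Subset.antisymm (fun _ hu => comp_trans h hu) fun _ hu => comp_trans (comp_symm h) hu

theorem notMem_of_mem_comp {l : List S} {s y : S} (h : y ∈ c.comp {x | x ∈ l} s) : y ∉ l :=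
  fun hy => Set.disjoint_left.1 (disjoint_comp _ _) h hy

theorem comp_anti {Z Z' : Set S} (h : Z ⊆ Z') (s : S) : c.comp Z' s ⊆ c.comp Z s :=
  fun _ ⟨F, hF, hd, hy⟩ => ⟨F, hF, hd.mono_right h, hy⟩

theorem isConn_comp (Z : Set S) (s : S) : c.IsConn (c.comp Z s) := by
  intro x hx y hy
  obtain ⟨F, hF, hd, hxF, hyF⟩ := comp_trans (comp_symm hx) hy
  exact ⟨F, hF, fun z hz => comp_trans hx ⟨F, hF, hd, hxF, hz⟩, hxF, hyF⟩

theorem IsConn.subset_comp {C Z : Set S} (hC : c.IsConn C) (hd : Disjoint C Z) {s : S}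
    (hs : s ∈ C) : C ⊆ c.comp Z s := by
  intro y hy
  obtain ⟨F, hF, hFC, h⟩ := hC s hs y hy
  exact ⟨F, hF, hd.mono_left hFC, h⟩

theorem Connected.comp_empty (hc : c.Connected) (s : S) : c.comp ∅ s = Set.univ :=
  Set.eq_univ_of_univ_subset
    (IsConn.subset_comp hc (Set.disjoint_empty _) (Set.mem_univ s))

variable (c) (next : List S → Set S → S)

open Classical in
/-- The first `n` vertices, in descending order, on the way from the root towards `s` in the tree
that grows by the rule `next`, which selects a vertex from every component left by a chain. -/
noncomputable def hist (s : S) : ℕ → List S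
  | 0 => []
  | n + 1 => if s ∈ hist s n then hist s n else
      next (hist s n) (c.comp {x | x ∈ hist s n} s) :: hist s n

variable {c next}

theorem hist_succ_of_mem {s : S} {n : ℕ} (h : s ∈ c.hist next s n) :
    c.hist next s (n + 1) = c.hist next s n := if_pos h

theorem hist_succ_of_notMem {s : S} {n : ℕ} (h : s ∉ c.hist next s n) :
    c.hist next s (n + 1) =
      next (c.hist next s n) (c.comp {x | x ∈ c.hist next s n} s) :: c.hist next s n := if_neg h

theorem hist_subset_succ (s : S) (n : ℕ) : c.hist next s n ⊆ c.hist next s (n + 1) := by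
  by_cases h : s ∈ c.hist next s n
  · rw [hist_succ_of_mem h]; exact List.Subset.refl _
  · rw [hist_succ_of_notMem h]; exact List.subset_cons_self _ _

theorem hist_subset {s : S} {m n : ℕ} (h : m ≤ n) : c.hist next s m ⊆ c.hist next s n := by
  induction n, h using Nat.le_induction with
  | base => exact List.Subset.refl _
  | succ n _ ih => exact List.Subset.trans ih (hist_subset_succ s n)

theorem hist_eq_of_mem {s : S} {m n : ℕ} (h : m ≤ n) (hs : s ∈ c.hist next s m) :
    c.hist next s n = c.hist next s m := by
  induction n, h using Nat.le_induction with
  | base => rfl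
  | succ n hmn ih => rw [hist_succ_of_mem (hist_subset hmn hs), ih]

/-- The rule sees only the history and the component, and elements in one component now were in one
component at all earlier stages. -/
theorem hist_eq_of_mem_comp {s y : S} {n : ℕ} (h : y ∈ c.comp {x | x ∈ c.hist next s n} s) :
    c.hist next y n = c.hist next s n := by
  induction n with
  | zero => rfl
  | succ n ih =>
    have h' : y ∈ c.comp {x | x ∈ c.hist next s n} s :=
      comp_anti (fun x hx => hist_subset_succ s n hx) s h
    have hy : y ∉ c.hist next s n := notMem_of_mem_comp h'
    have hs : s ∉ c.hist next s n := notMem_of_mem_comp (comp_symm h')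
    rw [hist_succ_of_notMem hs, ← comp_eq_of_mem h', ← ih h',
      hist_succ_of_notMem (by rwa [ih h'])]

theorem hist_succ_eq_of_mem_comp {s y : S} {n : ℕ}
    (h : y ∈ c.comp {x | x ∈ c.hist next s n} s) :
    c.hist next y (n + 1) = c.hist next s (n + 1) := by
  have hy : y ∉ c.hist next s n := notMem_of_mem_comp h
  have hs : s ∉ c.hist next s n := notMem_of_mem_comp (comp_symm h)
  have he := hist_eq_of_mem_comp h
  rw [hist_succ_of_notMem hs, hist_succ_of_notMem (by rwa [he]), he, comp_eq_of_mem h]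

/-- The rule selects an element of every nonempty set. -/
def Selects (next : List S → Set S → S) : Prop :=
  ∀ l K, K.Nonempty → next l K ∈ K

theorem Selects.next_mem_comp (hnext : Selects next) {s : S} {n : ℕ}
    (h : s ∉ c.hist next s n) :
    next (c.hist next s n) (c.comp {x | x ∈ c.hist next s n} s) ∈
      c.comp {x | x ∈ c.hist next s n} s :=
  hnext _ _ ⟨s, self_mem_comp h⟩

theorem Selects.nodup_hist (hnext : Selects next) (s : S) (n : ℕ) :
    (c.hist next s n).Nodup := by
  induction n with
  | zero => exact List.nodup_nil
  | succ n ih =>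
    by_cases h : s ∈ c.hist next s n
    · rwa [hist_succ_of_mem h]
    · rw [hist_succ_of_notMem h, List.nodup_cons]
      exact ⟨notMem_of_mem_comp (hnext.next_mem_comp h), ih⟩

theorem Selects.exists_of_mem_hist (hnext : Selects next) {s x : S} {n : ℕ}
    (h : x ∈ c.hist next s n) :
    ∃ k < n, s ∉ c.hist next s k ∧ x ∈ c.comp {x | x ∈ c.hist next s k} s ∧
      c.hist next s (k + 1) = x :: c.hist next s k := by
  induction n with
  | zero => simp [hist] at h
  | succ n ih =>
    by_cases hs : s ∈ c.hist next s n
    · rw [hist_succ_of_mem hs] at h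
      obtain ⟨k, hk, hk'⟩ := ih h
      exact ⟨k, by omega, hk'⟩
    · have h' := h
      rw [hist_succ_of_notMem hs, List.mem_cons] at h'
      rcases h' with rfl | h'
      · exact ⟨n, by omega, hs, hnext.next_mem_comp hs, hist_succ_of_notMem hs⟩
      · obtain ⟨k, hk, hk'⟩ := ih h'
        exact ⟨k, by omega, hk'⟩

variable (c next)

/-- The vertices of the tree that grows by the rule `next`. -/
def treeVerts : Set S := {s | ∃ n, s ∈ c.hist next s n}

open Classical in
/-- A vertex of the tree that grows by the rule `next`, followed by its proper ancestors in
descending order. -/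
noncomputable def chain (s : S) : List S :=
  if h : ∃ n, s ∈ c.hist next s n then c.hist next s (Nat.find h) else []

variable {c next}

theorem chain_eq_hist {s : S} {n : ℕ} (h : s ∈ c.hist next s n) :
    c.chain next s = c.hist next s n := by
  classical
  have hex : ∃ n, s ∈ c.hist next s n := ⟨n, h⟩
  rw [chain, dif_pos hex, hist_eq_of_mem (Nat.find_min' hex h) (Nat.find_spec hex)]

/-- When `x` was selected it lay in the component of `s`, so up to then both had the same history.
The chain of `x` is therefore an earlier history of `s`. -/
theorem Selects.chain_eq_of_mem_hist (hnext : Selects next) {s x : S} {n : ℕ}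
    (h : x ∈ c.hist next s n) :
    ∃ k < n, x ∈ c.comp {x | x ∈ c.hist next s k} s ∧ x ∈ c.treeVerts next ∧
      c.chain next x = c.hist next s (k + 1) ∧ c.chain next x = x :: c.hist next s k := by
  obtain ⟨k, hk, -, hx, he⟩ := hnext.exists_of_mem_hist h
  have hx' := hist_succ_eq_of_mem_comp hx
  have hxm : x ∈ c.hist next x (k + 1) := by rw [hx', he]; exact List.mem_cons_self
  have := chain_eq_hist hxm
  exact ⟨k, hk, hx, ⟨_, hxm⟩, by rw [this, hx'], by rw [this, hx', he]⟩

theorem Selects.exists_chain_eq (hnext : Selects next) {s : S} (hs : s ∈ c.treeVerts next) :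
    ∃ k, s ∉ c.hist next s k ∧ c.hist next s (k + 1) = s :: c.hist next s k ∧
      c.chain next s = s :: c.hist next s k ∧
      s = next (c.hist next s k) (c.comp {x | x ∈ c.hist next s k} s) := by
  obtain ⟨n, hn⟩ := hs
  obtain ⟨k, -, hk, -, he⟩ := hnext.exists_of_mem_hist hn
  refine ⟨k, hk, he, ?_, ?_⟩
  · rw [← he]
    exact chain_eq_hist (by rw [he]; exact List.mem_cons_self)
  · rw [hist_succ_of_notMem hk] at he
    exact (List.cons.inj he).1.symm

theorem mem_hist_of_mem_chain {s x : S} (hx : x ∈ c.chain next s) :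
    ∃ n, x ∈ c.hist next s n := by
  classical
  by_cases h : ∃ n, s ∈ c.hist next s n
  · rw [chain, dif_pos h] at hx
    exact ⟨_, hx⟩
  · simp [chain, dif_neg h] at hx

theorem mem_chain_of_mem_hist {s x : S} {n : ℕ} (hs : s ∈ c.treeVerts next)
    (h : x ∈ c.hist next s n) : x ∈ c.chain next s := by
  obtain ⟨m, hm⟩ := hs
  rw [chain_eq_hist (hist_subset (le_max_right n m) hm)]
  exact hist_subset (le_max_left n m) h

end Connectoid

/-! ### Countable hulls, agendas and diligent rules. -/

namespace Connectoid

variable {S : Type*} (c : Connectoid S)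

/-- There are uncountably many pairwise internally disjoint `X`--`Y` links. -/
def FatlyLinked (X Y : Set S) : Prop :=
  ∃ 𝓛 : Set (Set S), (∀ L ∈ 𝓛, c.IsLink X Y L) ∧
    (∀ L ∈ 𝓛, ∀ L' ∈ 𝓛, L ≠ L' → L ∩ L' ⊆ X ∪ Y) ∧ ¬ 𝓛.Countable

/-- `B` meets every `X`--`Y` link that is not contained in `X ∪ Y` outside of `X ∪ Y`. -/
def BlocksLinks (X Y B : Set S) : Prop :=
  ∀ L, c.IsLink X Y L → L ∩ B ⊆ X ∪ Y → L ⊆ X ∪ Y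

variable {c}

theorem BlocksLinks.mono {X Y B B' : Set S} (h : c.BlocksLinks X Y B) (hB : B ⊆ B') :
    c.BlocksLinks X Y B' :=
  fun L hL hLB => h L hL ((Set.inter_subset_inter_right L hB).trans hLB)

/-- Take the union of a maximal family of internally disjoint links. -/
theorem exists_countable_blocksLinks {X Y : Set S} (h : ¬ c.FatlyLinked X Y) :
    ∃ B : Set S, B.Countable ∧ c.BlocksLinks X Y B := by
  obtain ⟨𝓛, hmax⟩ := zorn_subset
    {𝓛 : Set (Set S) | (∀ L ∈ 𝓛, c.IsLink X Y L) ∧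
      ∀ L ∈ 𝓛, ∀ L' ∈ 𝓛, L ≠ L' → L ∩ L' ⊆ X ∪ Y} (by
    intro 𝒞 h𝒞 hchain
    refine ⟨⋃₀ 𝒞, ⟨?_, ?_⟩, fun 𝓛 => Set.subset_sUnion_of_mem⟩
    · rintro L ⟨𝓛, h𝓛, hL⟩
      exact (h𝒞 h𝓛).1 L hL
    · rintro L ⟨𝓛, h𝓛, hL⟩ L' ⟨𝓛', h𝓛', hL'⟩
      rcases hchain.total h𝓛 h𝓛' with hs | hs
      · exact (h𝒞 h𝓛').2 L (hs hL) L' hL'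
      · exact (h𝒞 h𝓛).2 L hL L' (hs hL'))
  have hcount : 𝓛.Countable := by
    by_contra hc
    exact h ⟨𝓛, hmax.prop.1, hmax.prop.2, hc⟩
  refine ⟨⋃₀ 𝓛, hcount.sUnion fun L hL => (hmax.prop.1 L hL).1.countable, fun L hL hLB => ?_⟩
  have hLL : ∀ L' ∈ 𝓛, L ∩ L' ⊆ X ∪ Y := fun L' hL' x hx => hLB ⟨hx.1, L', hL', hx.2⟩
  -- By maximality the family contains every link that meets its members only in `X ∪ Y`; such a
  -- link lies in the blocking set itself.
  have hmem : L ∈ 𝓛 := by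
    refine hmax.le_of_ge (y := insert L 𝓛) ⟨?_, ?_⟩ (Set.subset_insert _ _) (Set.mem_insert _ _)
    · rintro L' (rfl | hL')
      · exact hL
      · exact hmax.prop.1 L' hL'
    · rintro L₁ (rfl | h₁) L₂ (rfl | h₂) hne
      · exact absurd rfl hne
      · exact hLL L₂ h₂
      · rw [Set.inter_comm]; exact hLL L₁ h₁
      · exact hmax.prop.2 L₁ h₁ L₂ h₂ hne
  exact fun x hx => hLB ⟨hx, L, hmem, hx⟩

variable (c)

/-- `B` contains `A` together with witnesses for the connections and for the blockable pairs of
finite sets in `A`. -/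
structure IsHull (A B : Set S) : Prop where
  subset : A ⊆ B
  connects : ∀ Z ⊆ A, Z.Finite → ∀ x ∈ A, ∀ y ∈ A, y ∈ c.comp Z x →
    ∃ F ∈ c.fin, F ⊆ B ∧ Disjoint F Z ∧ x ∈ F ∧ y ∈ F
  blocks : ∀ X ⊆ A, X.Finite → ∀ Y ⊆ A, Y.Finite → ¬ c.FatlyLinked X Y → c.BlocksLinks X Y B

/-- A countable set has countably many finite subsets, and each requirement has a countable witness.
This is a single closing-off step: the new elements need no witnesses yet, because hulls are
iterated along a branch. -/
theorem exists_isHull {A : Set S} (hA : A.Countable) : ∃ B : Set S, B.Countable ∧ c.IsHull A B := by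
  have hF : ∀ (Z : Set S) (x y : S), ∃ F : Set S, F.Countable ∧
      (y ∈ c.comp Z x → F ∈ c.fin ∧ Disjoint F Z ∧ x ∈ F ∧ y ∈ F) := by
    intro Z x y
    by_cases h : y ∈ c.comp Z x
    · obtain ⟨F, hF, h'⟩ := h
      exact ⟨F, (c.finite_of_mem F hF).countable, fun _ => ⟨hF, h'⟩⟩
    · exact ⟨∅, Set.countable_empty, fun h' => absurd h' h⟩
  have hB : ∀ X Y : Set S, ∃ B : Set S, B.Countable ∧
      (¬ c.FatlyLinked X Y → c.BlocksLinks X Y B) := by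
    intro X Y
    by_cases h : c.FatlyLinked X Y
    · exact ⟨∅, Set.countable_empty, fun h' => absurd h h'⟩
    · obtain ⟨B, hB, hB'⟩ := exists_countable_blocksLinks h
      exact ⟨B, hB, fun _ => hB'⟩
  choose F hFc hF using hF
  choose B hBc hB using hB
  have hfin := Set.countable_ofPred_finite_subset hA
  refine ⟨A ∪ ((⋃ Z ∈ {Z : Set S | Z.Finite ∧ Z ⊆ A}, ⋃ x ∈ A, ⋃ y ∈ A, F Z x y) ∪
    ⋃ X ∈ {Z : Set S | Z.Finite ∧ Z ⊆ A}, ⋃ Y ∈ {Z : Set S | Z.Finite ∧ Z ⊆ A}, B X Y), ?_, ?_⟩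
  · refine hA.union (Set.Countable.union ?_ ?_)
    · exact hfin.biUnion fun Z _ => hA.biUnion fun x _ => hA.biUnion fun y _ => hFc Z x y
    · exact hfin.biUnion fun X _ => hfin.biUnion fun Y _ => hBc X Y
  · refine ⟨Set.subset_union_left, ?_, ?_⟩
    · intro Z hZ hZf x hx y hy h
      obtain ⟨h1, h2⟩ := hF Z x y h
      refine ⟨F Z x y, h1, fun w hw => Or.inr (Or.inl ?_), h2⟩
      simp only [Set.mem_iUnion]
      exact ⟨Z, ⟨hZf, hZ⟩, x, hx, y, hy, hw⟩
    · intro X hX hXf Y hY hYf h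
      refine (hB X Y h).mono fun w hw => Or.inr (Or.inr ?_)
      simp only [Set.mem_iUnion]
      exact ⟨X, ⟨hXf, hX⟩, Y, ⟨hYf, hY⟩, hw⟩

open Classical in
/-- A countable hull of a countable set. -/
noncomputable def hull (A : Set S) : Set S :=
  if h : A.Countable then (c.exists_isHull h).choose else ∅

theorem countable_hull (A : Set S) : (c.hull A).Countable := by
  by_cases h : A.Countable
  · rw [hull, dif_pos h]; exact (c.exists_isHull h).choose_spec.1
  · rw [hull, dif_neg h]; exact Set.countable_empty

theorem isHull_hull {A : Set S} (h : A.Countable) : c.IsHull A (c.hull A) := by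
  rw [hull, dif_pos h]; exact (c.exists_isHull h).choose_spec.2

/-- The countable set of elements that have to be dealt with by the time the vertices in the list
have been selected. -/
noncomputable def agenda : List S → Set S
  | [] => ∅
  | v :: l => c.hull (insert v (agenda l))

theorem countable_agenda (l : List S) : (c.agenda l).Countable := by
  cases l with
  | nil => exact Set.countable_empty
  | cons v l => exact c.countable_hull _

theorem isHull_agenda (v : S) (l : List S) :
    c.IsHull (insert v (c.agenda l)) (c.agenda (v :: l)) :=
  c.isHull_hull ((c.countable_agenda l).insert v)

/-- The first `n` members of a sequence in reverse order. -/
def initial (v : ℕ → S) : ℕ → List S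
  | 0 => []
  | n + 1 => v n :: initial v n

variable {c}

theorem length_initial (v : ℕ → S) (n : ℕ) : (initial v n).length = n := by
  induction n with
  | zero => rfl
  | succ n ih => rw [initial, List.length_cons, ih]

theorem drop_initial (v : ℕ → S) {m n : ℕ} (h : m ≤ n) :
    (initial v n).drop (n - m) = initial v m := by
  induction n, h using Nat.le_induction with
  | base => simp
  | succ n h ih => rw [Nat.succ_sub h, initial, List.drop_succ_cons, ih]

theorem mem_initial {v : ℕ → S} {x : S} {n : ℕ} : x ∈ initial v n ↔ ∃ k < n, v k = x := by
  induction n with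
  | zero => simp [initial]
  | succ n ih =>
    rw [initial, List.mem_cons, ih]
    constructor
    · rintro (rfl | ⟨k, hk, rfl⟩)
      · exact ⟨n, by omega, rfl⟩
      · exact ⟨k, by omega, rfl⟩
    · rintro ⟨k, hk, rfl⟩
      rcases Nat.lt_succ_iff_lt_or_eq.1 hk with h | rfl
      · exact Or.inr ⟨k, h, rfl⟩
      · exact Or.inl rfl

variable (c)

/-- A sequence of vertices selected by the rule `next`, each from the component that the previous
selections have led to. -/
structure IsBranch (next : List S → Set S → S) (v : ℕ → S) (D : ℕ → Set S) : Prop where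
  comp_eq : ∀ n, ∀ x ∈ D n, c.comp {y | y ∈ initial v n} x = D n
  nonempty : ∀ n, (D n).Nonempty
  succ_subset : ∀ n, D (n + 1) ⊆ D n
  eq_next : ∀ n, v n = next (initial v n) (D n)

/-- The elements on the agenda of some initial segment of a branch. -/
def agendaUnion (v : ℕ → S) : Set S := ⋃ n, c.agenda (initial v n)

/-- The rule selects `r` first, later infinitely often an element of a `W i` with least possible
`i`, and in between works off the agendas of the initial segments of the chain. -/
structure IsDiligent (r : S) (W : ℕ → Set S) (next : List S → Set S → S) : Prop where
  selects : Selects next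
  root : next [] Set.univ = r
  least : ∀ l ≠ [], (Nat.unpair l.length).1 = 0 → ∀ K i, (K ∩ W i).Nonempty →
    ∃ j ≤ i, next l K ∈ W j
  agenda : ∃ e : Set S → ℕ → S, (∀ A : Set S, A.Countable → A ⊆ Set.range (e A)) ∧
    ∀ l ≠ [], ∀ K j i, (Nat.unpair l.length).1 = Nat.pair j i + 1 →
      e (c.agenda (l.drop (l.length - j))) i ∈ K →
      next l K = e (c.agenda (l.drop (l.length - j))) i

/-- The length of the chain, decoded as a pair, is a timetable: the first coordinate names the duty
and the second makes it recur. Duty `0` concerns the `W i`; duty `Nat.pair j i + 1` asks for entry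
`i` of the agenda of the `j` oldest selections, which stand at the end of the list. Distinct codes
prevent conflicts. -/
theorem exists_isDiligent (r : S) (W : ℕ → Set S) : ∃ next, c.IsDiligent r W next := by
  classical
  have hleast : ∀ K : Set S, ∃ x, (K.Nonempty → x ∈ K) ∧
      ∀ i, (K ∩ W i).Nonempty → ∃ j ≤ i, x ∈ W j := by
    intro K
    by_cases h : ∃ i, (K ∩ W i).Nonempty
    · obtain ⟨x, hx, hxW⟩ := Nat.find_spec h
      exact ⟨x, fun _ => hx, fun i hi => ⟨_, Nat.find_min' h hi, hxW⟩⟩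
    · rcases K.eq_empty_or_nonempty with rfl | ⟨x, hx⟩
      · exact ⟨r, fun h => absurd h Set.not_nonempty_empty, fun i hi => absurd ⟨i, hi⟩ h⟩
      · exact ⟨x, fun _ => hx, fun i hi => absurd ⟨i, hi⟩ h⟩
  choose d hdK hdW using hleast
  have henum : ∀ A : Set S, ∃ e : ℕ → S, A.Countable → A ⊆ Set.range e := by
    intro A
    by_cases h : A.Countable ∧ A.Nonempty
    · obtain ⟨e, he⟩ := h.1.exists_eq_range h.2
      exact ⟨e, fun _ => he.subset⟩
    · refine ⟨fun _ => r, fun hA => ?_⟩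
      rw [not_and, Set.not_nonempty_iff_eq_empty] at h
      rw [h hA]
      exact Set.empty_subset _
  choose e he using henum
  have hnext : ∀ (l : List S) (K : Set S), ∃ x, (K.Nonempty → x ∈ K) ∧
      (l = [] → r ∈ K → x = r) ∧
      (l ≠ [] → (Nat.unpair l.length).1 = 0 → ∀ i, (K ∩ W i).Nonempty → ∃ j ≤ i, x ∈ W j) ∧
      ∀ j i, l ≠ [] → (Nat.unpair l.length).1 = Nat.pair j i + 1 →
        e (c.agenda (l.drop (l.length - j))) i ∈ K →
        x = e (c.agenda (l.drop (l.length - j))) i := by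
    intro l K
    by_cases hl : l = []
    · by_cases hr : r ∈ K
      · exact ⟨r, fun _ => hr, fun _ _ => rfl, fun h => absurd hl h, fun _ _ h => absurd hl h⟩
      · exact ⟨d K, hdK K, fun _ h => absurd h hr, fun h => absurd hl h,
          fun _ _ h => absurd hl h⟩
    · by_cases ha : ∃ j i, (Nat.unpair l.length).1 = Nat.pair j i + 1 ∧
        e (c.agenda (l.drop (l.length - j))) i ∈ K
      · obtain ⟨j, i, hji, hK⟩ := ha
        refine ⟨_, fun _ => hK, fun h => absurd h hl, fun _ h0 => by omega, ?_⟩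
        intro j' i' _ hji' _
        obtain ⟨rfl, rfl⟩ := Nat.pair_eq_pair.1 (Nat.succ_injective (hji.symm.trans hji'))
        rfl
      · exact ⟨d K, hdK K, fun h => absurd h hl, fun _ _ => hdW K,
          fun j i _ hji hK => absurd ⟨j, i, hji, hK⟩ ha⟩
  choose next h1 h2 h3 h4 using hnext
  exact ⟨next, h1, h2 _ _ rfl (Set.mem_univ r), fun l hl h0 K => h3 l K hl h0, e, he,
    fun l hl K j i => h4 l K j i hl⟩

end Connectoid

/-! ### Branches of a diligent rule: necklaces and fat `TK_{ℵ₀}`s. -/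

namespace Connectoid

variable {S : Type*} {c : Connectoid S}

theorem agenda_initial_subset (v : ℕ → S) (n : ℕ) :
    insert (v n) (c.agenda (initial v n)) ⊆ c.agenda (initial v (n + 1)) :=
  (c.isHull_agenda _ _).subset

theorem monotone_agenda_initial (v : ℕ → S) : Monotone fun n => c.agenda (initial v n) :=
  monotone_nat_of_le_succ fun n => (Set.subset_insert _ _).trans (agenda_initial_subset v n)

theorem mem_agendaUnion (v : ℕ → S) (n : ℕ) : v n ∈ c.agendaUnion v :=
  Set.mem_iUnion.2 ⟨n + 1, agenda_initial_subset v n (Set.mem_insert _ _)⟩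

theorem exists_subset_agenda_initial {v : ℕ → S} {X : Set S} (hX : X.Finite)
    (h : X ⊆ c.agendaUnion v) : ∃ n, X ⊆ c.agenda (initial v n) := by
  obtain ⟨I, hI, hXI⟩ := Set.finite_subset_iUnion hX h
  obtain ⟨n, hn⟩ := hI.bddAbove
  exact ⟨n, hXI.trans (Set.iUnion₂_subset fun i hi => monotone_agenda_initial v (hn hi))⟩

/-- Agendas increase, so the finite sets `X` and `Y` lie in a single one, and the next agenda
already blocks their links. -/
theorem blocksLinks_agendaUnion {v : ℕ → S} {X Y : Set S} (hX : X.Finite) (hY : Y.Finite)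
    (hXM : X ⊆ c.agendaUnion v) (hYM : Y ⊆ c.agendaUnion v) (h : ¬ c.FatlyLinked X Y) :
    c.BlocksLinks X Y (c.agendaUnion v) := by
  obtain ⟨n, hn⟩ := exists_subset_agenda_initial (hX.union hY) (Set.union_subset hXM hYM)
  have hn' := hn.trans (Set.subset_insert (v n) _)
  exact ((c.isHull_agenda _ _).blocks X (Set.subset_union_left.trans hn') hX Y
    (Set.subset_union_right.trans hn') hY h).mono
    (Set.subset_iUnion (fun n => c.agenda (initial v n)) (n + 1))

namespace IsBranch

variable {r : S} {W : ℕ → Set S} {next : List S → Set S → S} {v : ℕ → S} {D : ℕ → Set S}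

theorem antitone (hb : c.IsBranch next v D) : Antitone D :=
  antitone_nat_of_succ_le hb.succ_subset

theorem isConn (hb : c.IsBranch next v D) (n : ℕ) : c.IsConn (D n) := by
  obtain ⟨x, hx⟩ := hb.nonempty n
  rw [← hb.comp_eq n x hx]
  exact isConn_comp _ _

theorem notMem_initial (hb : c.IsBranch next v D) {n : ℕ} {x : S} (hx : x ∈ D n) :
    x ∉ initial v n := by
  rw [← hb.comp_eq n x hx] at hx
  exact notMem_of_mem_comp hx

theorem mem (hb : c.IsBranch next v D) (hs : Selects next) {n k : ℕ} (h : n ≤ k) : v k ∈ D n := by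
  apply hb.antitone h
  rw [hb.eq_next]
  exact hs _ _ (hb.nonempty k)

/-- At a stage reserved for `m`, either `m` has left the component already or it is selected, and
then it is missing from the next component. -/
theorem exists_notMem (hb : c.IsBranch next v D) (hd : c.IsDiligent r W next) {m : S}
    (hm : m ∈ c.agendaUnion v) : ∃ n, m ∉ D n := by
  obtain ⟨j, hj⟩ := Set.mem_iUnion.1 hm
  obtain ⟨e, he, hnext⟩ := hd.agenda
  obtain ⟨i, rfl⟩ := he _ (c.countable_agenda _) hj
  set a := Nat.pair j i + 1
  -- The second coordinate `j + 1` puts the stage after `j`, when the agenda in question is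
  -- available.
  obtain ⟨n, hn⟩ : ∃ n, n = Nat.pair a (j + 1) := ⟨_, rfl⟩
  have hjn : j < n := hn ▸ Nat.right_le_pair a (j + 1)
  by_contra! hcon
  have hl : initial v n ≠ [] := by
    intro h
    have := length_initial v n
    rw [h, List.length_nil] at this
    omega
  have hdrop : (initial v n).drop ((initial v n).length - j) = initial v j := by
    rw [length_initial, drop_initial v hjn.le]
  have hv := hnext _ hl (D n) j i (by rw [length_initial, hn, Nat.unpair_pair])
    (by rw [hdrop]; exact hcon n)
  rw [← hb.eq_next, hdrop] at hv
  exact hb.notMem_initial (hcon (n + 1)) (by rw [← hv]; exact List.mem_cons_self)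

theorem exists_disjoint (hb : c.IsBranch next v D) (hd : c.IsDiligent r W next) {X : Set S}
    (hX : X.Finite) (hXM : X ⊆ c.agendaUnion v) (k : ℕ) : ∃ n > k, Disjoint (D n) X := by
  induction X, hX using Set.Finite.induction_on with
  | empty => exact ⟨k + 1, by simp⟩
  | @insert x X _ _ ih =>
    obtain ⟨n, hn, hdis⟩ := ih ((Set.subset_insert _ _).trans hXM)
    obtain ⟨n', hn'⟩ := hb.exists_notMem hd (hXM (Set.mem_insert _ _))
    refine ⟨max n n', by omega, Set.disjoint_insert_right.2 ⟨fun h => ?_, ?_⟩⟩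
    · exact hn' (hb.antitone (le_max_right n n') h)
    · exact hdis.mono_left (hb.antitone (le_max_left n n'))

/-- The first `k` vertices form a finite subset of the agenda union, so the hulls contain a finite
connected set joining `x` to `y` and avoiding these vertices. Such a set stays in `D k`. -/
theorem isConn_inter (hb : c.IsBranch next v D) (k : ℕ) :
    c.IsConn (c.agendaUnion v ∩ D k) := by
  rintro x ⟨hxM, hx⟩ y ⟨hyM, hy⟩
  have hZ : {z | z ∈ initial v k} ⊆ c.agendaUnion v := by
    intro z hz
    obtain ⟨i, -, rfl⟩ := mem_initial.1 hz
    exact mem_agendaUnion v i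
  have hZf : {z | z ∈ initial v k}.Finite := List.finite_toSet _
  obtain ⟨n, hn⟩ := exists_subset_agenda_initial ((hZf.insert y).insert x)
    (Set.insert_subset hxM (Set.insert_subset hyM hZ))
  have hn' := hn.trans (Set.subset_insert (v n) _)
  obtain ⟨F, hF, hFB, hFZ, hxF, hyF⟩ := (c.isHull_agenda (v n) _).connects _
    (((Set.subset_insert _ _).trans (Set.subset_insert _ _)).trans hn') hZf x
    (hn' (Set.mem_insert _ _)) y (hn' (Set.mem_insert_of_mem _ (Set.mem_insert _ _)))
    (by rw [hb.comp_eq k x hx]; exact hy)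
  refine ⟨F, hF, fun z hz => ⟨Set.mem_iUnion.2 ⟨n + 1, hFB hz⟩, ?_⟩, hxF, hyF⟩
  rw [← hb.comp_eq k x hx]
  exact ⟨F, hF, hFZ, hxF, hz⟩

/-- The vertices of a branch lie in a common necklace. -/
theorem exists_isNecklace (hb : c.IsBranch next v D) (hd : c.IsDiligent r W next) :
    ∃ N, c.IsNecklace N ∧ ∀ n, v n ∈ N := by
  have hH : ∀ a b : ℕ, ∃ F : Set S, F.Finite ∧ c.IsConn F ∧ v '' Set.Icc a b ⊆ F ∧
      F ⊆ c.agendaUnion v ∩ D a := by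
    intro a b
    refine (hb.isConn_inter a).exists_finite_superset ((Set.finite_Icc a b).image v) ?_
    rintro _ ⟨n, hn, rfl⟩
    exact ⟨mem_agendaUnion v n, hb.mem hd.selects hn.1⟩
  choose H hHf hHc hHv hHs using hH
  choose g hg hgd using fun a b : ℕ =>
    hb.exists_disjoint hd (hHf a b) ((hHs a b).trans Set.inter_subset_left) b
  -- A pair `(a, b)` stands for a member containing `v a` to `v b`. The next member also contains `v
  -- b`, and all later ones lie in `D (g a b)`, which is disjoint from this member.
  let st : ℕ → ℕ × ℕ := fun i => (fun p => (p.2, g p.1 p.2))^[i] (0, 1)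
  have hst : ∀ i, st (i + 1) = ((st i).2, g (st i).1 (st i).2) :=
    fun i => Function.iterate_succ_apply' _ _ _
  have hlt : ∀ i, (st i).1 < (st i).2 := by
    intro i
    cases i with
    | zero => exact Nat.zero_lt_one
    | succ i => rw [hst]; exact hg _ _
  have hmono : Monotone fun i => (st i).1 := monotone_nat_of_le_succ fun i => by
    rw [hst]; exact (hlt i).le
  refine ⟨⋃ i, H (st i).1 (st i).2, isNecklace_iUnion (fun i => hHf _ _) (fun i => hHc _ _)
    (fun i => ⟨v (st i).2, ?_, ?_⟩) (fun i j hij => ?_), fun n => ?_⟩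
  · exact hHv _ _ ⟨_, ⟨(hlt i).le, le_rfl⟩, rfl⟩
  · refine hHv _ _ ⟨_, ⟨?_, ?_⟩, rfl⟩
    · rw [hst]
    · exact (by rw [hst] : (st i).2 = (st (i + 1)).1).trans_le (hlt (i + 1)).le
  · have h : (st (i + 2)).1 = g (st i).1 (st i).2 := by rw [hst, hst]
    refine (hgd (st i).1 (st i).2).symm.mono_right ?_
    rw [← h]
    exact ((hHs _ _).trans Set.inter_subset_right).trans (hb.antitone (hmono hij))
  · suffices h : ∃ i, (st i).1 ≤ n ∧ n ≤ (st i).2 by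
      obtain ⟨i, hi⟩ := h
      exact Set.mem_iUnion.2 ⟨i, hHv _ _ ⟨n, hi, rfl⟩⟩
    induction n with
    | zero => exact ⟨0, le_rfl, Nat.zero_le _⟩
    | succ n ih =>
      obtain ⟨i, hi, hi'⟩ := ih
      rcases hi'.lt_or_eq with h | h
      · exact ⟨i, by omega, h⟩
      · have h1 : (st (i + 1)).1 = (st i).2 := by rw [hst]
        have h2 := hlt (i + 1)
        exact ⟨i + 1, by omega, by omega⟩

/-- If some element of `W i` is never separated from a branch, then infinitely many vertices of the
branch lie in the same `W j`. -/
theorem exists_infinite (hb : c.IsBranch next v D) (hd : c.IsDiligent r W next) {i : ℕ} {u : S}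
    (hu : u ∈ W i) (huD : ∀ n, u ∈ D n) : ∃ j, {n | v n ∈ W j}.Infinite := by
  by_contra! hcon
  obtain ⟨b, hb'⟩ := ((Set.finite_le_nat i).biUnion fun j _ => hcon j).bddAbove
  -- A stage with duty `0` after the last index `b` at which a `W j` with `j ≤ i` was hit; `u`
  -- guarantees that one is hit again.
  set n := Nat.pair 0 (b + 1)
  have hbn : b < n := Nat.right_le_pair 0 (b + 1)
  have hl : initial v n ≠ [] := by
    intro h
    have := length_initial v n
    rw [h, List.length_nil] at this
    omega
  obtain ⟨j, hj, hjW⟩ := hd.least (initial v n) hl (by rw [length_initial, Nat.unpair_pair])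
    (D n) i ⟨u, huD n, hu⟩
  rw [← hb.eq_next] at hjW
  exact absurd (hb' (Set.mem_biUnion hj hjW)) (by omega)

/-- If some element is never separated from a branch, then any set containing infinitely many
vertices of the branch meets all branch sets of some fat `TK_{ℵ₀}`. -/
theorem exists_fatTK (hb : c.IsBranch next v D) (hd : c.IsDiligent r W next) {u : S}
    (huD : ∀ n, u ∈ D n) {A : Set S} (hA : {n | v n ∈ A}.Infinite) :
    ∃ K : c.FatTK, ∀ n, (K.branch n ∩ A).Nonempty := by
  have huM : u ∉ c.agendaUnion v := fun h => by
    obtain ⟨n, hn⟩ := hb.exists_notMem hd h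
    exact hn (huD n)
  -- `X` will be a branch set and `E` connects it to `u`. Take a finite connected `E` in `D k`
  -- through `u` and some `v n` in `A`, then enlarge its trace on the agenda union to a finite
  -- connected set `X` within that union and `D k`.
  have hX : ∀ k, ∃ X E : Set S, X.Finite ∧ c.IsConn X ∧ X ⊆ c.agendaUnion v ∧ X ⊆ D k ∧
      (X ∩ A).Nonempty ∧ E.Finite ∧ c.IsConn E ∧ u ∈ E ∧ (E ∩ X).Nonempty ∧
      E ∩ c.agendaUnion v ⊆ X := by
    intro k
    obtain ⟨n, hnA, hkn⟩ := hA.exists_gt k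
    have hvD : v n ∈ D k := hb.mem hd.selects hkn.le
    obtain ⟨E, hEf, hEc, huE, hED⟩ := (hb.isConn k).exists_finite_superset
      (A := {u, v n}) (by simp) (Set.insert_subset (huD k) (by simpa using hvD))
    have hvE : v n ∈ E := huE (by simp)
    obtain ⟨X, hXf, hXc, hEX, hXD⟩ := (hb.isConn_inter k).exists_finite_superset
      (hEf.inter_of_left (c.agendaUnion v)) fun x hx => ⟨hx.2, hED hx.1⟩
    have hvX : v n ∈ X := hEX ⟨hvE, mem_agendaUnion v n⟩
    exact ⟨X, E, hXf, hXc, hXD.trans Set.inter_subset_left, hXD.trans Set.inter_subset_right,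
      ⟨v n, hvX, hnA⟩, hEf, hEc, huE (by simp), ⟨v n, hvE, hvX⟩, hEX⟩
  choose X E hXf hXc hXM hXD hXA hEf hEc huE hEX hEM using hX
  choose g hg hgd using fun k => hb.exists_disjoint hd (hXf k) (hXM k) k
  let k : ℕ → ℕ := fun i => g^[i] 0
  have hk : ∀ i, k (i + 1) = g (k i) := fun i => Function.iterate_succ_apply' _ _ _
  have hkmono : Monotone k := monotone_nat_of_le_succ fun i => by rw [hk]; exact (hg _).le
  have hlt : ∀ i j, i < j → Disjoint (X (k i)) (X (k j)) := by
    intro i j hij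
    refine (hgd (k i)).symm.mono_right ((hXD _).trans ?_)
    rw [← hk]
    exact hb.antitone (hkmono hij)
  have hdisj : ∀ i j, i ≠ j → Disjoint (X (k i)) (X (k j)) := by
    intro i j hij
    rcases lt_or_gt_of_ne hij with h | h
    · exact hlt i j h
    · exact (hlt j i h).symm
  have hsep : ∀ i j, i ≠ j → X (k i) ⊆ (E (k i) ∪ X (k i)) \ (E (k j) ∪ X (k j)) := by
    intro i j hij x hx
    refine ⟨Or.inr hx, fun hx' => Set.disjoint_left.1 (hdisj i j hij) hx ?_⟩
    exact hx'.elim (fun h => hEM _ ⟨h, hXM _ hx⟩) id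
  have hEXc : ∀ i, c.IsConn (E i ∪ X i) := fun i => (hEc i).union (hXc i) (hEX i)
  -- Otherwise the agenda union would block the links of this pair. The link through `u` meets that
  -- union only in the two branch sets, so it would be contained in them, putting `u` into the
  -- agenda union.
  have hfat : ∀ i j, i ≠ j → c.FatlyLinked (X (k i)) (X (k j)) := by
    intro i j hij
    by_contra hnot
    have hne : ((E (k i) ∪ X (k i)) ∩ (E (k j) ∪ X (k j))).Nonempty :=
      ⟨u, Or.inl (huE _), Or.inl (huE _)⟩
    have hlink : c.IsLink (X (k i)) (X (k j)) ((E (k i) ∪ X (k i)) ∪ (E (k j) ∪ X (k j))) :=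
      ⟨((hEf _).union (hXf _)).union ((hEf _).union (hXf _)), (hEXc _).union (hEXc _) hne,
        _, _, rfl, hEXc _, hEXc _, hsep i j hij, hsep j i hij.symm, hne⟩
    have hsub := blocksLinks_agendaUnion (hXf _) (hXf _) (hXM _) (hXM _) hnot _ hlink (by
      rintro x ⟨(hx | hx) | (hx | hx), hxM⟩
      · exact Or.inl (hEM _ ⟨hx, hxM⟩)
      · exact Or.inl hx
      · exact Or.inr (hEM _ ⟨hx, hxM⟩)
      · exact Or.inr hx)
    exact huM ((hsub (Or.inl (Or.inl (huE _)))).elim (fun h => hXM _ h) fun h => hXM _ h)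
  choose! 𝓛 hL hLd hLu using hfat
  exact ⟨⟨fun i => X (k i), 𝓛, fun i => hXf _, fun i => hXc _, hdisj, hL, hLd, hLu⟩,
    fun i => hXA _⟩

end IsBranch

end Connectoid

/-! ### The tree of a diligent rule is normal and contains all `W n` (5 → 1). -/

namespace Connectoid

variable {S : Type*} {c : Connectoid S} {r : S} {W : ℕ → Set S} {next : List S → Set S → S}

theorem IsDiligent.hist_one (hd : c.IsDiligent r W next) (hc : c.Connected) (s : S) :
    c.hist next s 1 = [r] := by
  rw [hist_succ_of_notMem (by simp [hist])]
  simp [hist, hc.comp_empty, hd.root]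

theorem IsDiligent.chain_root (hd : c.IsDiligent r W next) (hc : c.Connected) :
    c.chain next r = [r] := by
  rw [chain_eq_hist (n := 1) (by rw [hd.hist_one hc]; exact List.mem_cons_self), hd.hist_one hc]

theorem IsDiligent.root_mem (hd : c.IsDiligent r W next) (hc : c.Connected) :
    r ∈ c.treeVerts next :=
  ⟨1, by rw [hd.hist_one hc]; exact List.mem_cons_self⟩

theorem IsDiligent.exists_parent (hd : c.IsDiligent r W next) (hc : c.Connected) {v : S}
    (hv : v ∈ c.treeVerts next) (hvr : v ≠ r) :
    ∃ u ∈ c.treeVerts next, c.chain next v = v :: c.chain next u := by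
  obtain ⟨k, hvk, hk, hchain, -⟩ := hd.selects.exists_chain_eq hv
  cases k with
  | zero =>
    rw [hd.hist_one hc] at hk
    exact absurd (List.cons.inj hk).1.symm hvr
  | succ k =>
    have hvk' : v ∉ c.hist next v k := fun h => hvk (hist_subset_succ v k h)
    have hhist := hist_succ_eq_of_mem_comp (hd.selects.next_mem_comp hvk')
    have hmem := hist_succ_of_notMem hvk'
    obtain ⟨x, hx⟩ : ∃ x, x = next (c.hist next v k) (c.comp {x | x ∈ c.hist next v k} v) :=
      ⟨_, rfl⟩
    rw [← hx] at hhist hmem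
    have hxm : x ∈ c.hist next x (k + 1) := by
      rw [hhist, hmem]
      exact List.mem_cons_self
    exact ⟨x, ⟨_, hxm⟩, by rw [hchain, ← hhist, chain_eq_hist hxm]⟩

theorem Selects.nodup_chain (hs : Selects next) (v : S) : (c.chain next v).Nodup := by
  classical
  rw [chain]
  split_ifs
  · exact hs.nodup_hist _ _
  · exact List.nodup_nil

/-- A connected set contains a common ancestor of any two vertices in it the second of which is not
an ancestor of the first. -/
theorem exists_mem_chain_of_isConn {C : Set S} (hC : c.IsConn C) {u v : S}
    (hu : u ∈ c.treeVerts next) (hv : v ∈ c.treeVerts next) (huC : u ∈ C) (hvC : v ∈ C)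
    (hvu : v ∉ c.chain next u) :
    ∃ w ∈ C, w ∈ c.chain next u ∧ w ∈ c.chain next v := by
  by_contra! hcon
  -- Without a common ancestor in `C`, the set `C` avoids every common history, so `u` and `v` are
  -- never separated and their histories agree forever.
  have key : ∀ n, c.hist next v n = c.hist next u n := by
    intro n
    induction n with
    | zero => rfl
    | succ n ih =>
      refine hist_succ_eq_of_mem_comp (hC.subset_comp (Set.disjoint_left.2 fun w hw hwn => ?_)
        huC hvC)
      exact hcon w hw (mem_chain_of_mem_hist hu hwn)
        (mem_chain_of_mem_hist hv (by rw [ih]; exact hwn))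
  obtain ⟨n, hn⟩ := hv
  exact hvu (mem_chain_of_mem_hist hu (by rwa [← key]))

/-- A vertex and its ancestor lie in a connected set without further ancestors of the latter. -/
theorem Selects.exists_isConn_of_mem_chain (hs : Selects next) {u v : S}
    (huv : u ∈ c.chain next v) :
    ∃ C, c.IsConn C ∧ u ∈ C ∧ v ∈ C ∧ ∀ w ∈ c.chain next u, w ≠ u → w ∉ C := by
  obtain ⟨n, hn⟩ := mem_hist_of_mem_chain huv
  obtain ⟨k, -, hu, -, -, hchain⟩ := hs.chain_eq_of_mem_hist hn
  refine ⟨_, isConn_comp _ _, hu,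
    self_mem_comp (Set.disjoint_left.1 (disjoint_comp _ _) (comp_symm hu)), fun w hw hwu hwC => ?_⟩
  rw [hchain, List.mem_cons] at hw
  exact notMem_of_mem_comp hwC (hw.resolve_left hwu)

/-- Translates a rooted ray of the tree into a branch, so that the necklace construction applies. -/
theorem Selects.isBranch_of_chain_eq (hs : Selects next) {v : ℕ → S}
    (hv : ∀ n, v n ∈ c.treeVerts next) (hchain : ∀ n, c.chain next (v n) = initial v (n + 1)) :
    c.IsBranch next v fun n => c.comp {y | y ∈ initial v n} (v n) := by
  have hhist : ∀ n, v n ∉ initial v n ∧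
      v n = next (initial v n) (c.comp {y | y ∈ initial v n} (v n)) := by
    intro n
    obtain ⟨k, hk, -, hck, hnk⟩ := hs.exists_chain_eq (hv n)
    rw [hchain] at hck
    rw [← (List.cons.inj hck).2] at hk hnk
    exact ⟨hk, hnk⟩
  refine ⟨fun n x hx => comp_eq_of_mem hx, fun n => ⟨_, self_mem_comp (hhist n).1⟩, fun n => ?_,
    fun n => (hhist n).2⟩
  obtain ⟨k, hk, -, hck, -⟩ := hs.exists_chain_eq (hv (n + 1))
  rw [hchain] at hck
  obtain ⟨j, -, hj, -, -, hcj⟩ := hs.chain_eq_of_mem_hist (c := c) (s := v (n + 1)) (x := v n)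
    (n := k) (by rw [← (List.cons.inj hck).2]; exact List.mem_cons_self)
  rw [hchain] at hcj
  rw [← (List.cons.inj hcj).2] at hj
  rw [comp_eq_of_mem hj]
  exact comp_anti (fun y hy => List.mem_cons_of_mem _ hy) _

/-- The history of an element that is never selected never freezes, so the successive selections in
its components form a branch from which it is never separated. -/
theorem exists_isBranch_of_notMem {u : S}
    (hu : u ∉ c.treeVerts next) : ∃ v D, c.IsBranch next v D ∧ ∀ n, u ∈ D n := by
  have hun : ∀ n, u ∉ c.hist next u n := fun n h => hu ⟨n, h⟩
  let v : ℕ → S := fun n => next (c.hist next u n) (c.comp {x | x ∈ c.hist next u n} u)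
  have hinit : ∀ n, initial v n = c.hist next u n := by
    intro n
    induction n with
    | zero => rfl
    | succ n ih => rw [initial, ih, hist_succ_of_notMem (hun n)]
  refine ⟨v, fun n => c.comp {x | x ∈ c.hist next u n} u, ⟨fun n x hx => ?_,
    fun n => ⟨u, self_mem_comp (hun n)⟩, fun n => ?_, fun n => ?_⟩,
    fun n => self_mem_comp (hun n)⟩
  · rw [hinit]
    exact comp_eq_of_mem hx
  · exact comp_anti (fun x hx => hist_subset_succ u n hx) u
  · rw [hinit]

/-- The tree grown by a diligent rule is a normal tree. -/
theorem IsDiligent.exists_isNormal (hd : c.IsDiligent r W next) (hc : c.Connected) :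
    ∃ T : RootedTreeIn S, c.IsNormal T ∧ (T.root : S) = r ∧ T.verts = c.treeVerts next := by
  obtain ⟨T, hT, hroot, hle, hadj⟩ := RootedTreeIn.exists_of_chains (c.treeVerts next) r
    (hd.root_mem hc) (c.chain next) (hd.chain_root hc) (fun v => hd.exists_parent hc)
    fun v _ => hd.selects.nodup_chain v
  have hmem : ∀ v : T.verts, (v : S) ∈ c.treeVerts next := fun v => hT ▸ v.2
  refine ⟨T, ⟨⟨fun C hC u v hu hv _ hvu => ?_, fun u v huv => ?_⟩, fun R hR => ?_⟩, hroot, hT⟩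
  · rw [hle] at hvu
    obtain ⟨w, hwC, hwu, hwv⟩ := exists_mem_chain_of_isConn hC (hmem u) (hmem v) hu hv hvu
    obtain ⟨n, hn⟩ := mem_hist_of_mem_chain hwu
    obtain ⟨-, -, -, hwV, -⟩ := hd.selects.chain_eq_of_mem_hist hn
    exact ⟨⟨w, hT ▸ hwV⟩, hwC, (hle _ _).2 hwu, (hle _ _).2 hwv⟩
  · obtain ⟨C, hC, huC, hvC, hav⟩ := hd.selects.exists_isConn_of_mem_chain ((hle u v).1 huv)
    exact ⟨C, hC, huC, hvC, fun w hw =>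
      hav w ((hle w u).1 hw.1) fun h => hw.2 (Subtype.ext h)⟩
  · obtain ⟨hR0, hRinj, hRadj⟩ := hR
    have h0 : c.chain next (R 0) = [(R 0 : S)] := by rw [hR0, hroot, hd.chain_root hc]
    -- A rooted ray never steps down: the root has no parent, and by uniqueness of parents a later
    -- step down would return to the preceding vertex.
    have hsucc : ∀ n, c.chain next (R (n + 1)) = (R (n + 1) : S) :: c.chain next (R n) := by
      intro n
      induction n with
      | zero =>
        refine (hadj _ _ (hRadj 0)).resolve_right fun h => ?_
        have hnil := (List.cons.inj (h0.symm.trans h)).2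
        obtain ⟨k, -, -, hk, -⟩ := hd.selects.exists_chain_eq (hmem (R (0 + 1)))
        rw [hk] at hnil
        exact List.cons_ne_nil _ _ hnil.symm
      | succ n ih =>
        refine (hadj _ _ (hRadj (n + 1))).resolve_right fun h => ?_
        have heq := (List.cons.inj (ih.symm.trans h)).2
        obtain ⟨k, -, -, hk, -⟩ := hd.selects.exists_chain_eq (hmem (R n))
        obtain ⟨k', -, -, hk', -⟩ := hd.selects.exists_chain_eq (hmem (R (n + 1 + 1)))
        rw [hk, hk'] at heq
        have := hRinj (Subtype.ext (List.cons.inj heq).1)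
        omega
    have hchain : ∀ n, c.chain next (R n) = initial (fun n => (R n : S)) (n + 1) := by
      intro n
      induction n with
      | zero => exact h0
      | succ n ih => rw [hsucc, ih]; rfl
    obtain ⟨N, hN, hRN⟩ := (hd.selects.isBranch_of_chain_eq (fun n => hmem (R n))
      hchain).exists_isNecklace hd
    exact ⟨N, hN, by simp [hRN]⟩

theorem IsDiligent.subset_treeVerts (hd : c.IsDiligent r W next)
    (hW : ∀ n, c.IsFatTKDispersed (W n)) : ⋃ n, W n ⊆ c.treeVerts next := by
  intro u hu
  by_contra hnot
  obtain ⟨i, hi⟩ := Set.mem_iUnion.1 hu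
  obtain ⟨v, D, hb, huD⟩ := exists_isBranch_of_notMem hnot
  obtain ⟨j, hj⟩ := hb.exists_infinite hd hi huD
  obtain ⟨K, hK⟩ := hb.exists_fatTK hd huD hj
  exact Set.infinite_univ ((hW j K).subset fun n _ => hK n)

end Connectoid

theorem theorem1p1 {S : Type*} [Nonempty S] (c : Connectoid S) (hc : c.Connected) (U : Set S) :
    List.TFAE [
      ∀ r : S, ∃ T : RootedTreeIn S, c.IsNormal T ∧ (T.root : S) = r ∧ U ⊆ T.verts,
      ∃ T : RootedTreeIn S, c.IsWeakNormal T ∧ U ⊆ T.verts,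
      ∃ T : RootedTreeIn S, c.IsQuasiWeakNormal T ∧ U ⊆ T.verts,
      ∃ W : ℕ → Set S, (∀ n, c.IsDispersed (W n)) ∧ U = ⋃ n, W n,
      ∃ W : ℕ → Set S, (∀ n, c.IsFatTKDispersed (W n)) ∧ U = ⋃ n, W n] := by
  tfae_have 1 → 2 := fun h => by
    obtain ⟨T, hT, -, hU⟩ := h (Classical.arbitrary S)
    exact ⟨T, hT.1, hU⟩
  tfae_have 2 → 3 := fun ⟨T, hT, hU⟩ => ⟨T, hT.1, hU⟩
  tfae_have 3 → 4 := by
    rintro ⟨T, hT, hU⟩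
    refine ⟨fun n => U ∩ {s | ∃ v : T.verts, (v : S) = s ∧ T.graph.dist T.root v = n},
      fun n N hN => ((hT.isDispersed_level n) N hN).subset
        (Set.inter_subset_inter_right _ Set.inter_subset_right), ?_⟩
    ext u
    simp only [Set.mem_iUnion]
    exact ⟨fun hu => ⟨_, hu, ⟨u, hU hu⟩, rfl, rfl⟩, fun ⟨_, hu, _⟩ => hu⟩
  tfae_have 4 → 5 := fun ⟨W, hW, hU⟩ => ⟨W, fun n => (hW n).isFatTKDispersed, hU⟩
  tfae_have 5 → 1 := by
    rintro ⟨W, hW, rfl⟩ r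
    obtain ⟨next, hd⟩ := c.exists_isDiligent r W
    obtain ⟨T, hT, hr, hV⟩ := hd.exists_isNormal hc
    exact ⟨T, hT, hr, hV ▸ hd.subset_treeVerts hW⟩
  tfae_finish
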